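/- Let $p\in(1,\infty)$, $c>0$, and let $(G,d)$ be a proper metric space which is * $p$-uniformly convex with constant $c$: any two points are joined by a (minimal, constant speed) geodesic $[0,1]\to G$, and for all $x,y,z\in G$, every geodesic $\gamma$ from $x$ to $y$ and all $t\in[0,1]$, $$d(z,\gamma(t))^p\le(1-t)\,d(z,x)^p+t\,d(z,y)^p-\tfrac c2\,t(1-t)\,d(x,y)^p;$$ * symmetric perpendicular: for all geodesics $\gamma,\gamma'$ with a common point $q$ one has $\gamma\perp_q\gamma'\iff\gamma'\perp_q\gamma$, where $\gamma\perp_q\gamma'$ means $d(u,q)\le d(u,v)$ for all $u\in\gamma$, $v\in\gamma'$. For $T\colon G\to G$ put $$\psi_T(x,y)=\tfrac c2\big(d(Tx,x)^p+d(Ty,y)^p+d(Tx,Ty)^p+d(x,y)^p-d(Tx,y)^p-d(x,Ty)^p\big).$$ $T$ is called *pointwise almost $\alpha$-firmly nonexpansive at $y$* with constant $\alpha\in(0,1)$ and violation $\epsilon\ge0$ if $$d(Tx,Ty)^p\le(1+\epsilon)\,d(x,y)^p-\tfrac{1-\alpha}{\alpha}\,\psi_T(x,y)\qquad\text{for all }x\in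 G,$$ and *almost quasi $\alpha$-firmly nonexpansive* with constant $\alpha$ and violation $\epsilon$ if $\operatorname{Fix}T\ne\emptyset$ and this holds at every $y\in\operatorname{Fix}T$ with the same $\alpha$ and $\epsilon$. **Theorem.** Let $(I,\mathcal I)$ be a measurable space with a probability measure $\eta$, and let $T_i\colon G\to G$ $(i\in I)$ be such that $(x,i)\mapsto T_ix$ is measurable (with $G$ carrying its Borel $\sigma$-algebra). Suppose that each $T_i$ is almost quasi $\alpha$-firmly nonexpansive with constant $\alpha_i\in(0,1)$ and violation $\epsilon_i\ge 0$, that $\overline\epsilon:=\sup_{i\in I}\epsilon_i<\infty$, and that for every $x\in G$ the push-forward of $\eta$ under $i\mapsto T_ix$ has finite $p$-th moments, i.e. $\int_I d(T_ix,z)^p\,\eta(di)<\infty$ for all $z\in G$. Put $\overline\alpha:=\sup_{i\in I}\alpha_i$. Then for every $x\in G$ the function $y\mapsto\int_I d(T_ix,y)^p\,\eta(di)$ has exactly one minimizer $b_p(T_i,\eta)(x)$ on $G$, and the operator $\mathscr T=b_p(T_i,\eta)\colon G\to G$ satisfies, for every $y\in\bigcap_{i\in I}\operatorname{Fix}T_i$: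 * if $\overline\alpha<1$, then $\mathscr T$ is pointwise almost $\alpha$-firmly nonexpansive at $y$ with constant $\overline\alpha$ and violation $\overline\epsilon$; * if $\overline\alpha=1$, then the same inequality holds at $y$ with $\overline\alpha=1$, that is, $d(\mathscr Tx,\mathscr Ty)^p\le(1+\overline\epsilon)\,d(x,y)^p$ for all $x\in G$. -/

import Mathlib

open MeasureTheory Set

namespace AlmostFirm

noncomputable section

/-- `γ`, restricted to `[0,1]`, is a (minimal, constant speed) geodesic from `x` to `y`. -/
def IsGeodesic {G : Type*} [MetricSpace G] (γ : ℝ → G) (x y : G) : Prop :=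
  γ 0 = x ∧ γ 1 = y ∧
    ∀ s ∈ Icc (0 : ℝ) 1, ∀ t ∈ Icc (0 : ℝ) 1, dist (γ s) (γ t) = |s - t| * dist x y

/-- Any two points are joined by a geodesic. -/
def IsGeodesicSpace (G : Type*) [MetricSpace G] : Prop :=
  ∀ x y : G, ∃ γ : ℝ → G, IsGeodesic γ x y

/-- `p`-uniform convexity with constant `c`; the point `(1 - t) x ⊕ t y` is `γ t` for a
geodesic `γ` from `x` to `y`. -/
def IsPUniformlyConvex (G : Type*) [MetricSpace G] (p c : ℝ) : Prop :=
  IsGeodesicSpace G ∧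
    ∀ (x y z : G) (γ : ℝ → G), IsGeodesic γ x y → ∀ t ∈ Icc (0 : ℝ) 1,
      dist z (γ t) ^ p ≤
        (1 - t) * dist z x ^ p + t * dist z y ^ p - c / 2 * t * (1 - t) * dist x y ^ p

/-- The trace (image) of a geodesic in `G`. -/
def IsGeodesicSegment {G : Type*} [MetricSpace G] (S : Set G) : Prop :=
  ∃ (x y : G) (γ : ℝ → G), IsGeodesic γ x y ∧ S = γ '' Icc (0 : ℝ) 1

/-- Perpendicularity `S ⊥_q S'` of two geodesics (given by their traces) through `q`. -/
def Perp {G : Type*} [MetricSpace G] (q : G) (S S' : Set G) : Prop :=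
  ∀ x ∈ S, ∀ y ∈ S', dist x q ≤ dist x y

/-- For any two geodesics with a common point `q`, perpendicularity at `q` is symmetric. -/
def IsSymmetricPerpendicular (G : Type*) [MetricSpace G] : Prop :=
  ∀ (S S' : Set G) (q : G), IsGeodesicSegment S → IsGeodesicSegment S' → q ∈ S → q ∈ S' →
    (Perp q S S' ↔ Perp q S' S)

/-- The transport discrepancy `ψ_T^{(p,c)}(x, y)`. -/
def transportDiscrepancy {G : Type*} [MetricSpace G] (p c : ℝ) (T : G → G) (x y : G) : ℝ :=
  c / 2 * (dist (T x) x ^ p + dist (T y) y ^ p + dist (T x) (T y) ^ p + dist x y ^ p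
    - dist (T x) y ^ p - dist x (T y) ^ p)

/-- `T` is pointwise almost nonexpansive at `y` on the whole space, with violation `ε`. -/
def IsPointwiseAlmostNonexpansive {G : Type*} [MetricSpace G] (p : ℝ) (T : G → G)
    (ε : ℝ) (y : G) : Prop :=
  0 ≤ ε ∧ ∀ x : G, dist (T x) (T y) ^ p ≤ (1 + ε) * dist x y ^ p

/-- `T` is pointwise almost `α`-firmly nonexpansive at `y` on the whole space, with constant `α`
and violation `ε`. -/
def IsPointwiseAlmostAlphaFirm {G : Type*} [MetricSpace G] (p c : ℝ) (T : G → G)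
    (α ε : ℝ) (y : G) : Prop :=
  0 < α ∧ α < 1 ∧ 0 ≤ ε ∧
    ∀ x : G, dist (T x) (T y) ^ p ≤
      (1 + ε) * dist x y ^ p - (1 - α) / α * transportDiscrepancy p c T x y

/-- `T` is almost quasi `α`-firmly nonexpansive on the whole space, with constant `α` and
violation `ε`: it has a fixed point, and is pointwise almost `α`-firmly nonexpansive at each of
its fixed points with the same `α` and `ε`. -/
def IsAlmostQuasiAlphaFirm {G : Type*} [MetricSpace G] (p c : ℝ) (T : G → G)
    (α ε : ℝ) : Prop :=
  (Function.fixedPoints T).Nonempty ∧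
    ∀ y ∈ Function.fixedPoints T, IsPointwiseAlmostAlphaFirm p c T α ε y

/-- The Borel probability measures on `G` with finite `p`-th moments. -/
def probMoment (G : Type*) [MetricSpace G] [MeasurableSpace G] (p : ℝ) : Set (Measure G) :=
  {ν | IsProbabilityMeasure ν ∧ ∀ x : G, Integrable (fun z => dist z x ^ p) ν}

/-- `b` is a value of `b_p(T_i, η)` at `x`, i.e. a minimizer over `y` of
`∫ d(T_i x, y)^p η(di)`. -/
def IsPBarycenterAt {G I : Type*} [MetricSpace G] [MeasurableSpace I] (p : ℝ) (T : I → G → G)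
    (η : Measure I) (x b : G) : Prop :=
  ∀ y : G, ∫ i, dist (T i x) b ^ p ∂η ≤ ∫ i, dist (T i x) y ^ p ∂η

/-- `F` is the `p`-barycenter operator `b_p(T_i, η)`. -/
def IsPBarycenterOperator {G I : Type*} [MetricSpace G] [MeasurableSpace I] (p : ℝ)
    (T : I → G → G) (η : Measure I) (F : G → G) : Prop :=
  ∀ x : G, IsPBarycenterAt p T η x (F x)

end

end AlmostFirm

namespace AlmostFirm

section Geodesic

variable {G : Type*} [MetricSpace G] {p c : ℝ}

/-! At a common fixed point `y` the discrepancy reduces to `c / 2 * d(T_i x, x)^p`. Since `(1 - α) /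
α` decreases in `α`, all points `T_i x` therefore lie in one sublevel set of `z ↦ d(z,y)^p + k
d(z,x)^p`, which is closed and geodesically convex. A barycenter of points of such a set stays in it
(`barycenter_mem`): by symmetric perpendicularity, projecting it onto the set brings it no farther
from those points (`dist_nearest_le`), so the projection is also a minimizer, and minimizers are
unique. As `y` is fixed by the barycenter operator too, membership is the claimed inequality. -/

/-- A set containing the trace of every geodesic between two of its points. -/
def IsGeodesicallyConvex (C : Set G) : Prop :=
  ∀ (u v : G) (γ : ℝ → G), u ∈ C → v ∈ C → IsGeodesic γ u v → ∀ t ∈ Icc (0 : ℝ) 1, γ t ∈ C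

/-- Sublevel sets of `z ↦ d(z,y)^p + k d(z,x)^p` are convex. -/
theorem isGeodesicallyConvex_sublevel (hc : 0 < c) (hconv : IsPUniformlyConvex G p c)
    (x y : G) {k : ℝ} (hk : 0 ≤ k) (r : ℝ) :
    IsGeodesicallyConvex {z : G | dist z y ^ p + k * dist z x ^ p ≤ r} := by
  intro u v γ hu hv hγ t ht
  simp only [mem_ofPred_eq] at hu hv ⊢
  have aux : ∀ w : G, dist (γ t) w ^ p ≤ (1 - t) * dist u w ^ p + t * dist v w ^ p := by
    intro w
    have h := hconv.2 u v w γ hγ t ht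
    have h0 : 0 ≤ c / 2 * t * (1 - t) * dist u v ^ p := by
      have h1 := ht.1
      have h2 : 0 ≤ 1 - t := sub_nonneg.2 ht.2
      positivity
    rw [dist_comm w, dist_comm w, dist_comm w] at h
    linarith
  have h1 := aux y
  have h2 := mul_le_mul_of_nonneg_left (aux x) hk
  have h3 := mul_le_mul_of_nonneg_left hu (sub_nonneg.2 ht.2)
  have h4 := mul_le_mul_of_nonneg_left hv ht.1
  linarith

/-- The metric projection onto a convex set does not increase distances to points of the set. -/
theorem dist_nearest_le (hgeo : IsGeodesicSpace G) (hperp : IsSymmetricPerpendicular G)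
    {C : Set G} (hC : IsGeodesicallyConvex C) {b q : G} (hq : q ∈ C)
    (hmin : ∀ v ∈ C, dist b q ≤ dist b v) {z : G} (hz : z ∈ C) : dist z q ≤ dist z b := by
  obtain ⟨γ, hγ⟩ := hgeo b q
  obtain ⟨δ, hδ⟩ := hgeo q z
  have h0 : (0 : ℝ) ∈ Icc (0 : ℝ) 1 := left_mem_Icc.2 zero_le_one
  have h1 : (1 : ℝ) ∈ Icc (0 : ℝ) 1 := right_mem_Icc.2 zero_le_one
  -- Since `γ s` lies on a geodesic from `b` to its nearest point `q`, the triangle inequality makes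
  -- `q` nearest to `γ s` as well, among points of the second geodesic.
  have hP : Perp q (γ '' Icc (0 : ℝ) 1) (δ '' Icc (0 : ℝ) 1) := by
    rintro _ ⟨s, hs, rfl⟩ _ ⟨t, ht, rfl⟩
    have hv := hmin _ (hC q z δ hq hz hδ t ht)
    have e0 := hγ.2.2 0 h0 s hs
    have e1 := hγ.2.2 s hs 1 h1
    rw [hγ.1, zero_sub, abs_neg, abs_of_nonneg hs.1] at e0
    rw [hγ.2.1, abs_sub_comm, abs_of_nonneg (sub_nonneg.2 hs.2)] at e1
    have := dist_triangle b (γ s) (δ t)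
    linarith
  exact (hperp _ _ q ⟨b, q, γ, hγ, rfl⟩ ⟨q, z, δ, hδ, rfl⟩ ⟨1, h1, hγ.2.1⟩ ⟨0, h0, hδ.1⟩).1 hP
    z ⟨1, h1, hδ.2.1⟩ b ⟨0, h0, hγ.1⟩

theorem dist_rpow_le (hp : 1 ≤ p) (u v w : G) :
    dist u w ^ p ≤ 2 ^ (p - 1) * (dist u v ^ p + dist v w ^ p) :=
  (Real.rpow_le_rpow dist_nonneg (dist_triangle u v w) (by linarith)).trans
    (by exact_mod_cast NNReal.rpow_add_le_mul_rpow_add_rpow (nndist u v) (nndist v w) hp)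

theorem continuous_dist_rpow (hp : 0 ≤ p) (w : G) : Continuous fun z : G => dist z w ^ p :=
  (continuous_id.dist continuous_const).rpow_const fun _ => Or.inr hp

theorem transportDiscrepancy_of_fixed (hp : p ≠ 0) {T : G → G} {y : G} (hy : T y = y) (x : G) :
    transportDiscrepancy p c T x y = c / 2 * dist (T x) x ^ p := by
  simp only [transportDiscrepancy, hy, dist_self, Real.zero_rpow hp]
  ring

end Geodesic

section Barycenter

variable {G I : Type*} [MetricSpace G] [MeasurableSpace I] {p c : ℝ} {η : Measure I} {f : I → G}

/-- Integrating `dist_rpow_le` through `f i` gives the coercivity needed for existence of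
minimizers. -/
theorem rpow_moment_le [IsProbabilityMeasure η] (hp : 1 ≤ p)
    (hf : ∀ w, Integrable (fun i => dist (f i) w ^ p) η) (u v : G) :
    dist u v ^ p ≤
      2 ^ (p - 1) * (∫ i, dist (f i) u ^ p ∂η + ∫ i, dist (f i) v ^ p ∂η) := by
  have h := integral_mono (μ := η) (integrable_const (dist u v ^ p))
    (((hf u).add (hf v)).const_mul (2 ^ (p - 1))) fun i => by
      simpa [dist_comm u] using dist_rpow_le hp u (f i) v
  rw [integral_const_mul] at h
  simp only [integral_const, probReal_univ, one_smul] at h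
  rwa [integral_add' (hf u) (hf v)] at h

theorem continuous_moment [IsProbabilityMeasure η] (hp : 1 ≤ p)
    (hf : ∀ w, Integrable (fun i => dist (f i) w ^ p) η) :
    Continuous fun w => ∫ i, dist (f i) w ^ p ∂η := by
  refine continuous_iff_continuousAt.2 fun w₀ => ?_
  refine continuousAt_of_dominated (bound := fun i => 2 ^ (p - 1) * (dist (f i) w₀ ^ p + 1))
    (Filter.Eventually.of_forall fun w => (hf w).aestronglyMeasurable) ?_
    (((hf w₀).add (integrable_const 1)).const_mul _)
    (Filter.Eventually.of_forall fun i => ?_)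
  · filter_upwards [Metric.ball_mem_nhds w₀ one_pos] with w hw
    refine Filter.Eventually.of_forall fun i => ?_
    rw [Real.norm_of_nonneg (by positivity)]
    refine (dist_rpow_le hp (f i) w₀ w).trans ?_
    gcongr
    exact Real.rpow_le_one dist_nonneg (Metric.mem_ball'.1 hw).le (by linarith)
  · exact ((continuous_const.dist continuous_id).rpow_const
      fun _ => Or.inr (by linarith)).continuousAt

theorem exists_forall_moment_le [ProperSpace G] [Nonempty G] [IsProbabilityMeasure η] (hp : 1 ≤ p)
    (hf : ∀ w, Integrable (fun i => dist (f i) w ^ p) η) :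
    ∃ b, ∀ w, ∫ i, dist (f i) b ^ p ∂η ≤ ∫ i, dist (f i) w ^ p ∂η := by
  obtain ⟨w₀⟩ := ‹Nonempty G›
  refine (continuous_moment hp hf).exists_forall_le' w₀ ?_
  have hlim : Filter.Tendsto (fun w => dist w w₀ ^ p) (Filter.cocompact G) Filter.atTop :=
    (tendsto_rpow_atTop (by linarith)).comp (tendsto_dist_right_cocompact_atTop w₀)
  -- The threshold is chosen so that cancelling `2 ^ (p - 1)` and one copy of the moment at `w₀`
  -- leaves the comparison with `w`.
  filter_upwards [hlim.eventually_ge_atTop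
    (2 ^ (p - 1) * (∫ i, dist (f i) w₀ ^ p ∂η + ∫ i, dist (f i) w₀ ^ p ∂η))] with w hw
  have h := le_of_mul_le_mul_left (hw.trans (rpow_moment_le hp hf w w₀))
    (Real.rpow_pos_of_pos two_pos _)
  linarith

/-- The midpoint of two distinct minimizers would have a moment smaller by at least `c / 8 *
d(b,b')^p`. -/
theorem eq_of_forall_moment_le (hc : 0 < c) (hconv : IsPUniformlyConvex G p c)
    [IsProbabilityMeasure η] (hf : ∀ w, Integrable (fun i => dist (f i) w ^ p) η) {b b' : G}
    (hb : ∀ w, ∫ i, dist (f i) b ^ p ∂η ≤ ∫ i, dist (f i) w ^ p ∂η)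
    (hb' : ∀ w, ∫ i, dist (f i) b' ^ p ∂η ≤ ∫ i, dist (f i) w ^ p ∂η) : b = b' := by
  obtain ⟨γ, hγ⟩ := hconv.1 b b'
  have hint : Integrable (fun i => 1 / 2 * dist (f i) b ^ p + 1 / 2 * dist (f i) b' ^ p) η :=
    ((hf b).const_mul _).add ((hf b').const_mul _)
  have h := integral_mono (μ := η) (hf (γ (1 / 2)))
    (hint.sub (integrable_const (c / 8 * dist b b' ^ p))) fun i => by
      have := hconv.2 b b' (f i) γ hγ (1 / 2) ⟨by norm_num, by norm_num⟩
      simp only [Pi.sub_apply]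
      linarith
  rw [integral_sub' hint (integrable_const _),
    integral_add ((hf b).const_mul _) ((hf b').const_mul _), integral_const_mul,
    integral_const_mul] at h
  simp only [integral_const, probReal_univ, one_smul] at h
  have h1 := hb (γ (1 / 2))
  have h2 := hb' (γ (1 / 2))
  by_contra hne
  have : 0 < c / 8 * dist b b' ^ p :=
    mul_pos (by positivity) (Real.rpow_pos_of_pos (dist_pos.2 hne) p)
  linarith

/-- The `p`-barycenter of points of a closed convex set lies in this set. -/
theorem barycenter_mem [ProperSpace G] [IsProbabilityMeasure η] (hp : 0 < p) (hc : 0 < c)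
    (hconv : IsPUniformlyConvex G p c) (hperp : IsSymmetricPerpendicular G)
    (hf : ∀ w, Integrable (fun i => dist (f i) w ^ p) η) {C : Set G} (hCc : IsClosed C)
    (hC : IsGeodesicallyConvex C) (hfC : ∀ i, f i ∈ C) {b : G}
    (hb : ∀ w, ∫ i, dist (f i) b ^ p ∂η ≤ ∫ i, dist (f i) w ^ p ∂η) : b ∈ C := by
  obtain ⟨i₀⟩ := η.nonempty_of_neZero
  obtain ⟨q, hq, hqd⟩ := hCc.exists_infDist_eq_dist ⟨_, hfC i₀⟩ b
  have hmin : ∀ v ∈ C, dist b q ≤ dist b v := fun v hv => hqd ▸ Metric.infDist_le_dist_of_mem hv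
  have hle : ∫ i, dist (f i) q ^ p ∂η ≤ ∫ i, dist (f i) b ^ p ∂η :=
    integral_mono (hf q) (hf b) fun i => Real.rpow_le_rpow dist_nonneg
      (dist_nearest_le hconv.1 hperp hC hq hmin (hfC i)) hp.le
  rwa [eq_of_forall_moment_le hc hconv hf hb fun w => hle.trans (hb w)]

end Barycenter

theorem IsPointwiseAlmostAlphaFirm.of_le {G : Type*} [MetricSpace G] {p c : ℝ} (hp : p ≠ 0)
    (hc : 0 < c) {T : G → G} {α ε : ℝ} {y : G} (h : IsPointwiseAlmostAlphaFirm p c T α ε y)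
    (hy : T y = y) {α' ε' : ℝ} (hα : α ≤ α') (hε : ε ≤ ε') (x : G) :
    dist (T x) y ^ p + (1 - α') / α' * (c / 2) * dist (T x) x ^ p ≤ (1 + ε') * dist x y ^ p := by
  have hx := h.2.2.2 x
  rw [transportDiscrepancy_of_fixed hp hy, hy] at hx
  have hα0 := h.1
  have hk : (1 - α') / α' ≤ (1 - α) / α := by
    rw [div_le_div_iff₀ (hα0.trans_le hα) hα0]
    nlinarith
  have h1 : (1 - α') / α' * (c / 2 * dist (T x) x ^ p) ≤
      (1 - α) / α * (c / 2 * dist (T x) x ^ p) := by gcongr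
  have h2 : (1 + ε) * dist x y ^ p ≤ (1 + ε') * dist x y ^ p := by gcongr
  linarith

end AlmostFirm

theorem theorem2p6 {G : Type*} [MetricSpace G] [ProperSpace G] [MeasurableSpace G] [BorelSpace G]
    {I : Type*} [MeasurableSpace I] (p c : ℝ) (hp : 1 < p) (hc : 0 < c)
    (hconv : AlmostFirm.IsPUniformlyConvex G p c)
    (hperp : AlmostFirm.IsSymmetricPerpendicular G)
    (T : I → G → G) (hT : Measurable (fun q : G × I => T q.2 q.1))
    (α ε : I → ℝ) (hfirm : ∀ i, AlmostFirm.IsAlmostQuasiAlphaFirm p c (T i) (α i) (ε i))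
    (hε : BddAbove (Set.range ε))
    (η : MeasureTheory.Measure I) [MeasureTheory.IsProbabilityMeasure η]
    (hη : ∀ x : G, η.map (fun i => T i x) ∈ AlmostFirm.probMoment G p) :
    (∀ x : G, ∃! b : G, AlmostFirm.IsPBarycenterAt p T η x b) ∧
    ∀ F : G → G, AlmostFirm.IsPBarycenterOperator p T η F →
      ∀ y ∈ ⋂ i, Function.fixedPoints (T i),
        ((⨆ i, α i) < 1 →
          AlmostFirm.IsPointwiseAlmostAlphaFirm p c F (⨆ i, α i) (⨆ i, ε i) y) ∧
        ((⨆ i, α i) = 1 →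
          AlmostFirm.IsPointwiseAlmostNonexpansive p F (⨆ i, ε i) y) := by
  have hp0 : 0 < p := by linarith
  have hTm : ∀ x, Measurable fun i => T i x := fun x => hT.comp measurable_prodMk_left
  have hint : ∀ x w, Integrable (fun i => dist (T i x) w ^ p) η := fun x w =>
    ((hη x).2 w).comp_measurable (hTm x)
  have huniq : ∀ x b b', AlmostFirm.IsPBarycenterAt p T η x b →
      AlmostFirm.IsPBarycenterAt p T η x b' → b = b' := fun x b b' hb hb' =>
    AlmostFirm.eq_of_forall_moment_le hc hconv (hint x) hb hb'
  refine ⟨fun x => ?_, fun F hF y hy => ?_⟩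
  · have : Nonempty G := ⟨x⟩
    obtain ⟨b, hb⟩ := AlmostFirm.exists_forall_moment_le hp.le (hint x)
    exact ⟨b, hb, fun b' hb' => huniq x b' b hb' hb⟩
  · have hTy : ∀ i, T i y = y := fun i => mem_iInter.1 hy i
    have hfirm' := fun i => (hfirm i).2 y (hTy i)
    have hFy : F y = y := huniq y _ _ (hF y) fun w => by
      simp only [hTy, dist_self, Real.zero_rpow hp0.ne', integral_zero]
      exact integral_nonneg fun _ => Real.rpow_nonneg dist_nonneg p
    obtain ⟨i₀⟩ := η.nonempty_of_neZero
    have hα : BddAbove (range α) := ⟨1, by rintro _ ⟨i, rfl⟩; exact (hfirm' i).2.1.le⟩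
    have hα0 : 0 < ⨆ i, α i := (hfirm' i₀).1.trans_le (le_ciSup hα i₀)
    have hε0 : 0 ≤ ⨆ i, ε i := (hfirm' i₀).2.2.1.trans (le_ciSup hε i₀)
    have key : (⨆ i, α i) ≤ 1 → ∀ x, dist (F x) y ^ p +
        (1 - ⨆ i, α i) / (⨆ i, α i) * (c / 2) * dist (F x) x ^ p ≤
          (1 + ⨆ i, ε i) * dist x y ^ p := fun hα1 x => by
      have hk : 0 ≤ (1 - ⨆ i, α i) / (⨆ i, α i) * (c / 2) :=
        mul_nonneg (div_nonneg (sub_nonneg.2 hα1) hα0.le) (by positivity)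
      exact AlmostFirm.barycenter_mem hp0 hc hconv hperp (hint x)
        (isClosed_le ((AlmostFirm.continuous_dist_rpow hp0.le y).add
          (continuous_const.mul (AlmostFirm.continuous_dist_rpow hp0.le x))) continuous_const)
        (AlmostFirm.isGeodesicallyConvex_sublevel hc hconv x y hk _)
        (fun i => (hfirm' i).of_le hp0.ne' hc (hTy i) (le_ciSup hα i) (le_ciSup hε i) x) (hF x)
    refine ⟨fun hα1 => ⟨hα0, hα1, hε0, fun x => ?_⟩, fun hα1 => ⟨hε0, fun x => ?_⟩⟩
    · rw [AlmostFirm.transportDiscrepancy_of_fixed hp0.ne' hFy, hFy]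
      linarith [key hα1.le x]
    -- Here the coefficient `(1 - α) / α` vanishes, so only the nonexpansive part remains.
    · simpa [hα1, hFy] using key hα1.le x
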